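/- For a cumulative distribution function (cdf) $F$ and $u\in(0,1)$ put $F^{\leftarrow}(u)=\inf\{x\in\mathbb R: F(x)\ge u\}$, and let $\mu$ be Lebesgue measure. For two sequences $(U_n)$, $(V_n)$ of real random variables on a probability space, write $U_n\le_{\mathrm{ast}}V_n$ as $n\to\infty$ if $$\lim_{n\to\infty}\mu\bigl(\{u\in(0,1): F_{U_n}^{\leftarrow}(u)>F_{V_n}^{\leftarrow}(u)\}\bigr)=0,$$ and $U_n\le_{\mathrm{asp}}V_n$ as $n\to\infty$ if $\liminf_{n\to\infty}P\{U_n\le V_n\}\ge 1/2$. For a sequence $(X_n)_{n\ge1}$ of real random variables let $X_{i:m}$ be the $i$-th smallest of $X_1,\dots,X_m$. For an integer $k\ge1$ the upper $k$-th record times are $T_1^{(k)}=1$ and $T_{n+1}^{(k)}=\min\{i\ge 1: X_{i:i+k-1}>X_{T_n^{(k)}:T_n^{(k)}+k-1}\}$, and the upper $k$-th record values are $R_n^{(k)}=X_{T_n^{(k)}:T_n^{(k)}+k-1}$, $n\ge1$. (For iid random variables with a continuous cdf these are almost surely well defined.) **Theorem.** Let $F_X$ and $F_Y$ be two continuous cdfs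 such that there exists $d\in\mathbb R$ with $F_Y(d)<1$ and $F_X(x)\ge F_Y(x)$ for every $x\ge d$. Let $(X_n)_{n\ge1}$ and $(Y_n)_{n\ge1}$ be two sequences of iid random variables on a common probability space, with respective cdfs $F_X$ and $F_Y$ and respective upper $k$-th record values $R_n^{(k)}$ and $S_n^{(k)}$. Then $R_n^{(k)}\le_{\mathrm{ast}}S_n^{(k)}$ as $n\to\infty$, for every integer $k\ge1$. Furthermore, if the two sequences $(X_n)$ and $(Y_n)$ are independent of each other, then $R_n^{(k)}\le_{\mathrm{asp}}S_n^{(k)}$ as $n\to\infty$, for every integer $k\ge1$. -/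

import Mathlib

open MeasureTheory ProbabilityTheory Filter Set
open scoped ENNReal Topology

noncomputable section

/-- The left-continuous inverse `g^←(u) = inf {x ∈ ℝ : g(x) ≥ u}` of a real function. -/
def leftContInverse (g : ℝ → ℝ) (u : ℝ) : ℝ :=
  sInf {x : ℝ | u ≤ g x}

/-- Asymptotic usual stochastic order `X_t ≤_ast Y_t` as `t → ∞`: the Lebesgue measure of the set
of `u ∈ (0,1)` at which the quantile function of `X_t` exceeds that of `Y_t` tends to `0`. -/
def AsympUsualOrder {Ω T : Type*} [MeasurableSpace Ω] [Preorder T] (P : Measure Ω)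
    (X Y : T → Ω → ℝ) : Prop :=
  Tendsto
    (fun t : T => volume {u : ℝ | u ∈ Ioo (0 : ℝ) 1 ∧
      leftContInverse (cdf (P.map (Y t))) u < leftContInverse (cdf (P.map (X t))) u})
    atTop (𝓝 0)

/-- Asymptotic stochastic precedence order `X_t ≤_asp Y_t` as `t → ∞`:
`liminf_{t → ∞} P {X_t ≤ Y_t} ≥ 1/2`. -/
def AsympPrecedenceOrder {Ω T : Type*} [MeasurableSpace Ω] [Preorder T] (P : Measure Ω)
    (X Y : T → Ω → ℝ) : Prop :=
  (1 / 2 : ℝ≥0∞) ≤ liminf (fun t : T => P {ω | X t ω ≤ Y t ω}) atTop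

/-- The order statistic `x_{i:m}` (`1 ≤ i ≤ m`), the `i`-th smallest of the first `m` terms
`x 0, …, x (m - 1)` of a sequence: the least `t` such that at least `i` of these terms
(counted with multiplicity) are `≤ t`. -/
def orderStat (x : ℕ → ℝ) (i m : ℕ) : ℝ :=
  sInf {t : ℝ | i ≤ ((Finset.range m).filter (fun j => x j ≤ t)).card}

/-- The upper `k`-th record times of the sequence whose first term is `x 0`. The times count from
`1` and the records from `0`: `recordTime x k n` is `T_{n+1}^{(k)}`, where `T_1^{(k)} = 1` and
`T_{n+1}^{(k)} = min {i ≥ 1 : x_{i:i+k-1} > x_{T_n^{(k)}:T_n^{(k)}+k-1}}`. -/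
def recordTime (x : ℕ → ℝ) (k : ℕ) : ℕ → ℕ
  | 0 => 1
  | n + 1 => sInf {i : ℕ | 1 ≤ i ∧
      orderStat x (recordTime x k n) (recordTime x k n + k - 1) < orderStat x i (i + k - 1)}

/-- The upper `k`-th record values: `recordValue x k n` is
`R_{n+1}^{(k)} = x_{T:T+k-1}` with `T = T_{n+1}^{(k)}`. -/
def recordValue (x : ℕ → ℝ) (k n : ℕ) : ℝ :=
  orderStat x (recordTime x k n) (recordTime x k n + k - 1)

end

/-! As `F` is continuous, the `F (X i)` are iid uniform and almost surely distinct. So `F` is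
strictly increasing on the sample and carries record values to record values (`recordValue_comp`).
Likewise for `G` and `Y`. Hence `F(R_n)` and `G(S_n)` share the law of a uniform record value; its
cdf `H_n` is atomless, and `R_n`, `S_n` have cdfs `H_n ∘ F`, `H_n ∘ G`. Uniform records tend almost
surely to `1`, so `H_n(c) → 0` for `c < 1`.

Beyond `d` one has `H_n ∘ G ≤ H_n ∘ F`, so the quantiles can be in the wrong order only for `u ≤
H_n(G d) → 0`. If the samples are independent, `F(R_n) < G(S_n)` has probability `1/2` by symmetry.
On this event, if also `S_n > d`, then `F(R_n) < G(S_n) ≤ F(S_n)` forces `R_n < S_n`. -/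

/-! ### Order statistics -/

/-- For `1 ≤ i ≤ m` the infimum defining the order statistic is attained, at one of the terms. -/
theorem exists_isLeast_orderStat (x : ℕ → ℝ) {i m : ℕ} (hi : 1 ≤ i) (him : i ≤ m) :
    ∃ j, IsLeast {t : ℝ | i ≤ ((Finset.range m).filter (fun j => x j ≤ t)).card} (x j) := by
  classical
  have hne : ((Finset.range m).filter
      (fun j => i ≤ ((Finset.range m).filter (fun l => x l ≤ x j)).card)).Nonempty := by
    obtain ⟨j, hj, hmax⟩ := Finset.exists_max_image (Finset.range m) x
      ⟨0, Finset.mem_range.2 (by omega)⟩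
    refine ⟨j, Finset.mem_filter.2 ⟨hj, ?_⟩⟩
    rw [Finset.filter_true_of_mem hmax, Finset.card_range]
    exact him
  obtain ⟨j, hj, hmin⟩ := Finset.exists_min_image _ x hne
  refine ⟨j, (Finset.mem_filter.1 hj).2, fun t ht => ?_⟩
  have ht' : i ≤ ((Finset.range m).filter (fun j => x j ≤ t)).card := ht
  -- The largest sample term `x l ≤ t` has the same terms below it as `t`.
  obtain ⟨l, hl, hlmax⟩ := Finset.exists_max_image ((Finset.range m).filter (fun j => x j ≤ t)) x
    (Finset.card_pos.1 (by omega))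
  have hl' := Finset.mem_filter.1 hl
  refine (hmin l (Finset.mem_filter.2 ⟨hl'.1, ht'.trans (Finset.card_le_card ?_)⟩)).trans hl'.2
  intro a ha
  exact Finset.mem_filter.2 ⟨(Finset.mem_filter.1 ha).1, hlmax a ha⟩

theorem exists_orderStat_eq (x : ℕ → ℝ) {i m : ℕ} (hi : 1 ≤ i) (him : i ≤ m) :
    ∃ j, orderStat x i m = x j :=
  let ⟨j, hj⟩ := exists_isLeast_orderStat x hi him
  ⟨j, hj.csInf_eq⟩

theorem orderStat_le_iff (x : ℕ → ℝ) {i m : ℕ} (hi : 1 ≤ i) (him : i ≤ m) (t : ℝ) :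
    orderStat x i m ≤ t ↔ i ≤ ((Finset.range m).filter (fun j => x j ≤ t)).card := by
  obtain ⟨j, hj⟩ := exists_isLeast_orderStat x hi him
  have h : orderStat x i m = x j := hj.csInf_eq
  rw [h]
  refine ⟨fun hjt => le_trans hj.1 (Finset.card_le_card ?_), fun ht => hj.2 ht⟩
  intro a ha
  exact Finset.mem_filter.2 ⟨(Finset.mem_filter.1 ha).1, (Finset.mem_filter.1 ha).2.trans hjt⟩

/-- Order statistics commute with maps that are strictly increasing on the sample. -/
theorem orderStat_comp {x : ℕ → ℝ} {φ : ℝ → ℝ} (hφ : StrictMonoOn φ (range x)) {i m : ℕ}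
    (hi : 1 ≤ i) (him : i ≤ m) : orderStat (fun j => φ (x j)) i m = φ (orderStat x i m) := by
  have key : ∀ l, orderStat (fun j => φ (x j)) i m ≤ φ (x l) ↔ orderStat x i m ≤ x l := by
    intro l
    rw [orderStat_le_iff _ hi him, orderStat_le_iff _ hi him]
    simp only [hφ.le_iff_le (mem_range_self _) (mem_range_self l)]
  obtain ⟨a, ha⟩ := exists_orderStat_eq x hi him
  obtain ⟨b, hb⟩ := exists_orderStat_eq (fun j => φ (x j)) hi him
  apply le_antisymm
  · rw [ha]
    exact (key a).2 ha.le
  · rw [hb, ha, hφ.le_iff_le (mem_range_self _) (mem_range_self b), ← ha]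
    exact (key b).1 hb.le

/-- The `k`-th largest of the first `i + k - 1` terms is nondecreasing in `i`. -/
theorem orderStat_add_mono (x : ℕ → ℝ) {k : ℕ} (hk : 1 ≤ k) {i j : ℕ} (hi : 1 ≤ i) (hij : i ≤ j) :
    orderStat x i (i + k - 1) ≤ orderStat x j (j + k - 1) := by
  induction j, hij using Nat.le_induction with
  | base => exact le_rfl
  | succ j hij ih =>
    refine ih.trans ?_
    rw [orderStat_le_iff x (by omega) (by omega)]
    have h := (orderStat_le_iff x (i := j + 1) (m := j + 1 + k - 1) (by omega) (by omega) _).1 le_rfl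
    -- Dropping the last term lowers the count by at most one, as the rank does.
    rw [show j + 1 + k - 1 = (j + k - 1) + 1 by omega] at h ⊢
    rw [Finset.range_add_one, Finset.filter_insert] at h
    split_ifs at h
    · have := Finset.card_insert_le (j + k - 1) ((Finset.range (j + k - 1)).filter
        (fun l => x l ≤ orderStat x (j + 1) (j + k - 1 + 1)))
      omega
    · omega

/-- If infinitely many terms exceed `c`, so does the `k`-th largest of sufficiently many terms. -/
theorem exists_lt_orderStat {x : ℕ → ℝ} {k : ℕ} (hk : 1 ≤ k) {c : ℝ}
    (hc : ∃ᶠ j in atTop, c < x j) : ∃ i, 1 ≤ i ∧ c < orderStat x i (i + k - 1) := by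
  obtain ⟨s, hs, hcard⟩ := (Nat.frequently_atTop_iff_infinite.1 hc).exists_subset_card_eq k
  obtain ⟨N, hN⟩ := s.bddAbove
  refine ⟨N + 1, by omega, ?_⟩
  by_contra! h
  rw [orderStat_le_iff x (by omega) (by omega)] at h
  -- Among `N + k` terms, `N + 1` that are `≤ c` and `k` that are `> c` are one too many.
  have hdisj : Disjoint ((Finset.range (N + 1 + k - 1)).filter (fun j => x j ≤ c)) s := by
    rw [Finset.disjoint_left]
    intro a ha has
    exact absurd (hs has) (not_lt.2 (Finset.mem_filter.1 ha).2)
  have hsub : ((Finset.range (N + 1 + k - 1)).filter (fun j => x j ≤ c)) ∪ s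
      ⊆ Finset.range (N + 1 + k - 1) := by
    refine Finset.union_subset (Finset.filter_subset _ _) fun a ha => Finset.mem_range.2 ?_
    have := hN ha
    omega
  have := Finset.card_le_card hsub
  rw [Finset.card_union_of_disjoint hdisj, Finset.card_range] at this
  omega

/-! ### Record times and record values -/

/-- The conditions under which all record values of a sequence in `(-∞, 1)` are well defined and
tend to `1`. -/
def AccumulatesAtOne (x : ℕ → ℝ) : Prop :=
  (∀ j, x j < 1) ∧ ∀ c < 1, ∃ᶠ j in atTop, c < x j

theorem AccumulatesAtOne.nonempty_recordTime {x : ℕ → ℝ} (h : AccumulatesAtOne x) {k : ℕ}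
    (hk : 1 ≤ k) {m : ℕ} (hm : 1 ≤ m) :
    {i : ℕ | 1 ≤ i ∧ orderStat x m (m + k - 1) < orderStat x i (i + k - 1)}.Nonempty := by
  obtain ⟨a, ha⟩ := exists_orderStat_eq x (i := m) (m := m + k - 1) hm (by omega)
  exact exists_lt_orderStat hk (h.2 _ (ha ▸ h.1 a))

/-- The order statistic is nondecreasing in the time, so a strict increase needs a strictly later
time. -/
theorem AccumulatesAtOne.lt_recordTime {x : ℕ → ℝ} (h : AccumulatesAtOne x) {k : ℕ} (hk : 1 ≤ k)
    (n : ℕ) : n < recordTime x k n := by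
  induction n with
  | zero => simp [recordTime]
  | succ n ih =>
    have hmem := Nat.sInf_mem (h.nonempty_recordTime hk (m := recordTime x k n) (by omega))
    have heq : recordTime x k (n + 1) = sInf {i : ℕ | 1 ≤ i ∧
      orderStat x (recordTime x k n) (recordTime x k n + k - 1) < orderStat x i (i + k - 1)} := rfl
    rw [← heq] at hmem
    by_contra! hle
    exact absurd hmem.2 (not_lt.2 (orderStat_add_mono x hk hmem.1 (by omega)))

theorem AccumulatesAtOne.exists_recordValue_eq {x : ℕ → ℝ} (h : AccumulatesAtOne x) {k : ℕ}
    (hk : 1 ≤ k) (n : ℕ) : ∃ j, recordValue x k n = x j :=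
  have := h.lt_recordTime hk n
  exists_orderStat_eq x (by omega) (by omega)

theorem AccumulatesAtOne.eventually_lt_recordValue {x : ℕ → ℝ} (h : AccumulatesAtOne x) {k : ℕ}
    (hk : 1 ≤ k) {c : ℝ} (hc : c < 1) : ∀ᶠ n in atTop, c < recordValue x k n := by
  obtain ⟨i, hi, hci⟩ := exists_lt_orderStat hk (h.2 c hc)
  filter_upwards [eventually_ge_atTop i] with n hn
  have := h.lt_recordTime hk n
  exact hci.trans_le (orderStat_add_mono x hk hi (by omega))

/-- Record values commute with maps that are strictly increasing on the sample. -/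
theorem recordValue_comp {x : ℕ → ℝ} {φ : ℝ → ℝ} (hφ : StrictMonoOn φ (range x))
    (h : AccumulatesAtOne fun j => φ (x j)) {k : ℕ} (hk : 1 ≤ k) (n : ℕ) :
    recordValue (fun j => φ (x j)) k n = φ (recordValue x k n) := by
  -- Record times depend only on comparisons between sample terms, which `φ` preserves.
  have hT : ∀ n, recordTime x k n = recordTime (fun j => φ (x j)) k n := by
    intro n
    induction n with
    | zero => rfl
    | succ n ih =>
      have hpos := h.lt_recordTime hk n
      simp only [recordTime]
      rw [ih]
      congr 1
      ext i
      refine and_congr_right fun hi => ?_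
      rw [orderStat_comp hφ (by omega) (by omega), orderStat_comp hφ hi (by omega)]
      obtain ⟨a, ha⟩ := exists_orderStat_eq x (i := recordTime (fun j => φ (x j)) k n)
        (m := recordTime (fun j => φ (x j)) k n + k - 1) (by omega) (by omega)
      obtain ⟨b, hb⟩ := exists_orderStat_eq x (i := i) (m := i + k - 1) hi (by omega)
      rw [ha, hb, hφ.lt_iff_lt (mem_range_self _) (mem_range_self _)]
  have hpos := h.lt_recordTime hk n
  simp only [recordValue, hT]
  exact orderStat_comp hφ (by omega) (by omega)

/-! ### Measurability -/

theorem measurable_orderStat (i m : ℕ) : Measurable fun x : ℕ → ℝ => orderStat x i m := by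
  by_cases hi : 1 ≤ i
  · by_cases him : i ≤ m
    · refine measurable_of_Iic fun t => ?_
      have : (fun x : ℕ → ℝ => orderStat x i m) ⁻¹' Iic t =
          {x | i ≤ ∑ j ∈ Finset.range m, (Iic t).indicator (fun _ => 1) (x j)} := by
        ext x
        simp only [mem_preimage, mem_Iic, orderStat_le_iff x hi him, mem_ofPred_eq,
          Finset.card_filter, indicator_apply]
      rw [this]
      exact measurableSet_le measurable_const (Finset.measurable_sum _ fun j _ =>
        (measurable_const.indicator measurableSet_Iic).comp (measurable_pi_apply j))
    · have : (fun x : ℕ → ℝ => orderStat x i m) = fun _ => 0 := by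
        funext x
        have hempty : {t : ℝ | i ≤ ((Finset.range m).filter (fun j => x j ≤ t)).card} = ∅ := by
          ext t
          have := Finset.card_filter_le (Finset.range m) (fun j => x j ≤ t)
          rw [Finset.card_range] at this
          simp only [mem_ofPred_eq, mem_empty_iff_false, iff_false]
          omega
        rw [orderStat, hempty, Real.sInf_empty]
      rw [this]
      exact measurable_const
  · obtain rfl : i = 0 := by omega
    simp [orderStat]

theorem measurable_natSInf {α : Type*} [MeasurableSpace α] {p : α → ℕ → Prop}
    (hp : ∀ i, MeasurableSet {a | p a i}) : Measurable fun a => sInf {i | p a i} := by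
  classical
  refine measurable_to_nat fun b => ?_
  set m := sInf {i | p b i}
  -- The second piece accounts for the default `sInf ∅ = 0`.
  have : (fun a => sInf {i | p a i}) ⁻¹' {m} =
      ({a | p a m} ∩ ⋂ i ∈ Iio m, {a | p a i}ᶜ) ∪ ({a | m = 0} ∩ ⋂ i, {a | p a i}ᶜ) := by
    ext a
    simp only [mem_preimage, mem_singleton_iff, mem_union, mem_inter_iff, mem_iInter, mem_Iio,
      mem_compl_iff, mem_ofPred_eq]
    constructor
    · intro h
      rcases eq_empty_or_nonempty {i | p a i} with he | hne
      · right
        refine ⟨by rw [← h, he, Nat.sInf_empty], fun i hi => ?_⟩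
        have : i ∈ {i | p a i} := hi
        simp [he] at this
      · left
        refine ⟨h ▸ Nat.sInf_mem hne, fun i hi => ?_⟩
        exact Nat.notMem_of_lt_sInf (h.symm ▸ hi)
    · rintro (⟨h1, h2⟩ | ⟨h1, h2⟩)
      · exact le_antisymm (Nat.sInf_le h1) (not_lt.1 fun hlt => h2 _ hlt (Nat.sInf_mem ⟨m, h1⟩))
      · have : {i | p a i} = ∅ := eq_empty_of_forall_notMem h2
        rw [this, Nat.sInf_empty, h1]
  rw [this]
  exact ((hp m).inter (MeasurableSet.biInter (to_countable _) fun i _ => (hp i).compl)).union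
    ((MeasurableSet.const _).inter (MeasurableSet.iInter fun i => (hp i).compl))

theorem measurable_orderStat_of_nat (k : ℕ) {T : (ℕ → ℝ) → ℕ} (hT : Measurable T) :
    Measurable fun x : ℕ → ℝ => orderStat x (T x) (T x + k - 1) := by
  have h : Measurable fun q : (ℕ → ℝ) × ℕ => orderStat q.1 q.2 (q.2 + k - 1) :=
    measurable_from_prod_countable_left fun i => measurable_orderStat i (i + k - 1)
  exact h.comp (measurable_id.prodMk hT)

theorem measurable_recordTime (k n : ℕ) : Measurable fun x : ℕ → ℝ => recordTime x k n := by
  induction n with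
  | zero => exact measurable_const
  | succ n ih =>
    refine measurable_natSInf fun i => ?_
    exact (MeasurableSet.const _).inter
      (measurableSet_lt (measurable_orderStat_of_nat k ih) (measurable_orderStat _ _))

theorem measurable_recordValue (k n : ℕ) : Measurable fun x : ℕ → ℝ => recordValue x k n :=
  measurable_orderStat_of_nat k (measurable_recordTime k n)

/-! ### Records of uniform samples -/

section Uniform

variable {Ω : Type*} [MeasurableSpace Ω] {P : Measure Ω} [IsProbabilityMeasure P]

/-- The probability integral transform. -/
theorem map_cdf_comp_eq_uniform {F : StieltjesFunction ℝ} (hF : Continuous F) {X : Ω → ℝ}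
    (hX : Measurable X) (hcdf : cdf (P.map X) = F) :
    P.map (fun ω => F (X ω)) = volume.restrict (Icc (0 : ℝ) 1) := by
  have : IsProbabilityMeasure (P.map X) := Measure.isProbabilityMeasure_map hX.aemeasurable
  have hFX : Measurable fun ω => F (X ω) := hF.measurable.comp hX
  have h0 : ∀ x, 0 ≤ F x := fun x => hcdf ▸ cdf_nonneg _ x
  have h1 : ∀ x, F x ≤ 1 := fun x => hcdf ▸ cdf_le_one _ x
  have hle : ∀ x, P {ω | X ω ≤ x} = ENNReal.ofReal (F x) := by
    intro x
    rw [← hcdf, ofReal_cdf, Measure.map_apply hX measurableSet_Iic]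
    rfl
  have hsurj : ∀ c ∈ Ioo (0 : ℝ) 1, ∃ x, F x = c := by
    intro c hc
    obtain ⟨a, ha⟩ := ((hcdf ▸ tendsto_cdf_atBot (P.map X)).eventually_lt_const hc.1).exists
    obtain ⟨b, hb⟩ := ((hcdf ▸ tendsto_cdf_atTop (P.map X)).eventually_const_lt hc.2).exists
    exact mem_range_of_exists_le_of_exists_ge hF ⟨a, ha.le⟩ ⟨b, hb.le⟩
  have hlt : ∀ c ∈ Ioo (0 : ℝ) 1, P {ω | F (X ω) < c} ≤ ENNReal.ofReal c := by
    intro c hc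
    obtain ⟨x, rfl⟩ := hsurj c hc
    rw [← hle]
    exact measure_mono fun ω hω => (F.mono.reflect_lt hω).le
  -- `F` may be flat at level `c`, so the strict bound is used at `c' > c` and `c'` decreases to
  -- `c`.
  have hupper : ∀ c, 0 ≤ c → c < 1 → P {ω | F (X ω) ≤ c} ≤ ENNReal.ofReal c := by
    intro c hc0 hc1
    have hlim : Tendsto ENNReal.ofReal (𝓝[>] c) (𝓝 (ENNReal.ofReal c)) :=
      ENNReal.continuous_ofReal.continuousWithinAt
    refine ge_of_tendsto hlim ?_
    filter_upwards [Ioo_mem_nhdsGT hc1] with c' hc'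
    exact (measure_mono fun ω (hω : F (X ω) ≤ c) => hω.trans_lt hc'.1).trans
      (hlt c' ⟨hc0.trans_lt hc'.1, hc'.2⟩)
  have : IsProbabilityMeasure (P.map fun ω => F (X ω)) :=
    Measure.isProbabilityMeasure_map hFX.aemeasurable
  refine Measure.ext_of_Iic _ _ fun c => ?_
  rw [Measure.map_apply hFX measurableSet_Iic, Measure.restrict_apply measurableSet_Iic]
  change P {ω | F (X ω) ≤ c} = _
  rcases lt_or_ge c 0 with hc0 | hc0
  · have e1 : {ω | F (X ω) ≤ c} = ∅ :=
      eq_empty_of_forall_notMem fun ω hω => absurd (h0 (X ω)) (not_le.2 (lt_of_le_of_lt hω hc0))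
    have e2 : Iic c ∩ Icc (0 : ℝ) 1 = ∅ :=
      eq_empty_of_forall_notMem fun y hy => absurd (hy.2.1.trans hy.1) (not_le.2 hc0)
    rw [e1, e2, measure_empty, measure_empty]
  rcases lt_or_ge c 1 with hc1 | hc1
  · have e2 : Iic c ∩ Icc (0 : ℝ) 1 = Icc 0 c := by
      ext y
      simp only [mem_inter_iff, mem_Iic, mem_Icc]
      constructor
      · rintro ⟨h, h', -⟩
        exact ⟨h', h⟩
      · rintro ⟨h, h'⟩
        exact ⟨h', h, h'.trans hc1.le⟩
    rw [e2, Real.volume_Icc, sub_zero]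
    refine le_antisymm (hupper c hc0 hc1) ?_
    -- The value `0` need not be attained by `F`.
    rcases hc0.eq_or_lt with rfl | hc0
    · simp
    · obtain ⟨x, rfl⟩ := hsurj c ⟨hc0, hc1⟩
      rw [← hle]
      exact measure_mono fun ω hω => F.mono hω
  · have e1 : {ω | F (X ω) ≤ c} = univ := eq_univ_of_forall fun ω => (h1 _).trans hc1
    have e2 : Iic c ∩ Icc (0 : ℝ) 1 = Icc 0 1 :=
      inter_eq_right.2 fun y hy => hy.2.trans hc1
    rw [e1, e2, measure_univ, Real.volume_Icc]
    simp

variable {U : ℕ → Ω → ℝ}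

/-- Second Borel–Cantelli lemma, at the countably many thresholds `1 - 1/(m+1)`. -/
theorem ae_accumulatesAtOne_of_uniform (hUm : ∀ i, Measurable (U i)) (hind : iIndepFun U P)
    (hlaw : ∀ i, P.map (U i) = volume.restrict (Icc (0 : ℝ) 1)) :
    ∀ᵐ ω ∂P, AccumulatesAtOne fun i => U i ω := by
  have hlt : ∀ᵐ ω ∂P, ∀ j, U j ω < 1 := by
    refine ae_all_iff.2 fun j => ?_
    refine ae_of_ae_map (p := fun y => y < 1) (hUm j).aemeasurable ?_
    rw [hlaw j]
    have hne : ∀ᵐ y ∂(volume.restrict (Icc (0 : ℝ) 1)), y ≠ 1 :=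
      (countable_singleton 1).ae_notMem _
    filter_upwards [hne, ae_restrict_mem measurableSet_Icc] with y hy hy'
    exact lt_of_le_of_ne hy'.2 hy
  have hfreq : ∀ m : ℕ, ∀ᵐ ω ∂P, ∃ᶠ j in atTop, 1 - 1 / ((m : ℝ) + 1) < U j ω := by
    intro m
    set c : ℝ := 1 - 1 / ((m : ℝ) + 1)
    have hpos : 0 < 1 / ((m : ℝ) + 1) := by positivity
    have hle1 : 1 / ((m : ℝ) + 1) ≤ 1 := by
      rw [div_le_one (by positivity)]
      linarith [(Nat.cast_nonneg m : (0 : ℝ) ≤ m)]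
    have hc0 : 0 ≤ c := sub_nonneg.2 hle1
    have hc1 : c < 1 := sub_lt_self _ hpos
    have hsm : ∀ j, MeasurableSet (U j ⁻¹' Ioi c) := fun j => hUm j measurableSet_Ioi
    have hmeas : ∀ j, P (U j ⁻¹' Ioi c) = ENNReal.ofReal (1 - c) := by
      intro j
      rw [← Measure.map_apply (hUm j) measurableSet_Ioi, hlaw,
        Measure.restrict_apply measurableSet_Ioi]
      have : Ioi c ∩ Icc (0 : ℝ) 1 = Ioc c 1 := by
        ext y
        simp only [mem_inter_iff, mem_Ioi, mem_Icc, mem_Ioc]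
        constructor
        · rintro ⟨h, -, h'⟩
          exact ⟨h, h'⟩
        · rintro ⟨h, h'⟩
          exact ⟨h, hc0.trans h.le, h'⟩
      rw [this, Real.volume_Ioc]
    have hset : iIndepSet (fun j => U j ⁻¹' Ioi c) P := by
      rw [iIndepSet_iff_meas_biInter hsm]
      intro s
      exact hind.measure_inter_preimage_eq_mul s fun _ _ => measurableSet_Ioi
    have hsum : (∑' j, P (U j ⁻¹' Ioi c)) = ∞ := by
      simp only [hmeas]
      exact ENNReal.tsum_const_eq_top_of_ne_zero (by simpa using hc1)
    have hone := measure_limsup_eq_one hsm hset hsum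
    have hmem : ∀ᵐ ω ∂P, ω ∈ limsup (fun j => U j ⁻¹' Ioi c) atTop :=
      (mem_ae_iff_prob_eq_one (MeasurableSet.measurableSet_limsup hsm)).2 hone
    filter_upwards [hmem] with ω hω
    exact mem_limsup_iff_frequently_mem.1 hω
  filter_upwards [hlt, ae_all_iff.2 hfreq] with ω h1 h2
  refine ⟨h1, fun c hc => ?_⟩
  obtain ⟨m, hm⟩ := exists_nat_one_div_lt (sub_pos.2 hc)
  exact (h2 m).mono fun j hj => by linarith

/-- By Fubini: for each fixed value of `A`, the atomless `B` avoids it. -/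
theorem ProbabilityTheory.IndepFun.ae_ne {A B : Ω → ℝ} (hAB : IndepFun A B P) (hA : Measurable A)
    (hB : Measurable B) [NullSingletonClass (P.map B)] : ∀ᵐ ω ∂P, A ω ≠ B ω := by
  refine ae_of_ae_map (p := fun q : ℝ × ℝ => q.1 ≠ q.2) (hA.prodMk hB).aemeasurable ?_
  rw [(indepFun_iff_map_prod_eq_prod_map_map hA.aemeasurable hB.aemeasurable).1 hAB]
  refine (Measure.ae_prod_iff_ae_ae (p := fun q : ℝ × ℝ => q.1 ≠ q.2)
    (measurableSet_eq_fun measurable_fst measurable_snd).compl).2 (ae_of_all _ fun x => ?_)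
  filter_upwards [(countable_singleton x).ae_notMem (P.map B)] with y hy
  exact Ne.symm hy

theorem ae_injective_of_uniform (hUm : ∀ i, Measurable (U i)) (hind : iIndepFun U P)
    (hlaw : ∀ i, P.map (U i) = volume.restrict (Icc (0 : ℝ) 1)) :
    ∀ᵐ ω ∂P, Function.Injective fun i => U i ω := by
  have h : ∀ i j, i ≠ j → ∀ᵐ ω ∂P, U i ω ≠ U j ω := by
    intro i j hij
    have : NullSingletonClass (P.map (U j)) := by
      rw [hlaw j]
      infer_instance
    exact (hind.indepFun hij).ae_ne (hUm i) (hUm j)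
  filter_upwards [ae_all_iff.2 fun i => ae_all_iff.2 fun j =>
    (eventually_imp_distrib_left (p := i ≠ j)).2 (h i j)] with ω hω i j hij
  by_contra hne
  exact hω i j hne hij

/-- A record value is almost surely one of countably many terms, each of which almost surely avoids
`c`. -/
theorem nullSingletonClass_map_recordValue_of_uniform (hUm : ∀ i, Measurable (U i))
    (hind : iIndepFun U P) (hlaw : ∀ i, P.map (U i) = volume.restrict (Icc (0 : ℝ) 1))
    {k : ℕ} (hk : 1 ≤ k) (n : ℕ) :
    NullSingletonClass (P.map fun ω => recordValue (fun i => U i ω) k n) := by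
  have hm : Measurable fun ω => recordValue (fun i => U i ω) k n :=
    (measurable_recordValue k n).comp (measurable_pi_lambda _ hUm)
  refine ⟨fun c => ?_⟩
  rw [Measure.map_apply hm (measurableSet_singleton c)]
  have hne : ∀ᵐ ω ∂P, ∀ j, U j ω ≠ c := by
    refine ae_all_iff.2 fun j => ae_of_ae_map (p := fun y => y ≠ c) (hUm j).aemeasurable ?_
    rw [hlaw j]
    exact (countable_singleton c).ae_notMem _
  have : ∀ᵐ ω ∂P, recordValue (fun i => U i ω) k n ∉ ({c} : Set ℝ) := by
    filter_upwards [hne, ae_accumulatesAtOne_of_uniform hUm hind hlaw] with ω h1 h2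
    obtain ⟨j, hj⟩ := h2.exists_recordValue_eq hk n
    exact hj ▸ h1 j
  exact measure_eq_zero_iff_ae_notMem.2 this

theorem tendsto_measure_recordValue_le_of_uniform (hUm : ∀ i, Measurable (U i))
    (hind : iIndepFun U P) (hlaw : ∀ i, P.map (U i) = volume.restrict (Icc (0 : ℝ) 1))
    {k : ℕ} (hk : 1 ≤ k) {c : ℝ} (hc : c < 1) :
    Tendsto (fun n => P {ω | recordValue (fun i => U i ω) k n ≤ c}) atTop (𝓝 0) := by
  have hm : ∀ n, MeasurableSet {ω | recordValue (fun i => U i ω) k n ≤ c} := fun n =>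
    ((measurable_recordValue k n).comp (measurable_pi_lambda _ hUm)) measurableSet_Iic
  rw [← measure_empty (μ := P)]
  refine tendsto_measure_of_ae_tendsto_indicator_of_isFiniteMeasure atTop MeasurableSet.empty hm ?_
  filter_upwards [ae_accumulatesAtOne_of_uniform hUm hind hlaw] with ω hω
  filter_upwards [hω.eventually_lt_recordValue hk hc] with n hn
  simpa using hn

theorem map_recordValue_eq_of_uniform {V : ℕ → Ω → ℝ}
    (hUm : ∀ i, Measurable (U i)) (hVm : ∀ i, Measurable (V i))
    (hUind : iIndepFun U P) (hVind : iIndepFun V P)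
    (hU : ∀ i, P.map (U i) = volume.restrict (Icc (0 : ℝ) 1))
    (hV : ∀ i, P.map (V i) = volume.restrict (Icc (0 : ℝ) 1)) (k n : ℕ) :
    P.map (fun ω => recordValue (fun i => U i ω) k n) =
      P.map (fun ω => recordValue (fun i => V i ω) k n) := by
  have h : P.map (fun ω i => U i ω) = P.map (fun ω i => V i ω) := by
    rw [(iIndepFun_iff_map_fun_eq_infinitePi_map hUm).1 hUind,
      (iIndepFun_iff_map_fun_eq_infinitePi_map hVm).1 hVind]
    simp only [hU, hV]
  have e : ∀ W : ℕ → Ω → ℝ, (∀ i, Measurable (W i)) →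
      P.map (fun ω => recordValue (fun i => W i ω) k n) =
        (P.map fun ω i => W i ω).map fun x => recordValue x k n := fun W hW => by
    rw [Measure.map_map (measurable_recordValue k n) (measurable_pi_lambda _ hW)]
    rfl
  rw [e U hUm, e V hVm, h]

/-- Of two independent random variables with the same atomless law, each is the smaller one with
probability one half. -/
theorem measure_lt_eq_half_of_indepFun {A B : Ω → ℝ} (hA : Measurable A) (hB : Measurable B)
    (hAB : IndepFun A B P) (hlaw : P.map A = P.map B) [NullSingletonClass (P.map B)] :
    P {ω | A ω < B ω} = 1 / 2 := by
  have : IsProbabilityMeasure (P.map B) := Measure.isProbabilityMeasure_map hB.aemeasurable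
  have hp : P.map (fun ω => (A ω, B ω)) = (P.map B).prod (P.map B) := by
    rw [(indepFun_iff_map_prod_eq_prod_map_map hA.aemeasurable hB.aemeasurable).1 hAB, hlaw]
  have hp' : P.map (fun ω => (B ω, A ω)) = (P.map B).prod (P.map B) := by
    rw [(indepFun_iff_map_prod_eq_prod_map_map hB.aemeasurable hA.aemeasurable).1 hAB.symm, hlaw]
  have hms : MeasurableSet {q : ℝ × ℝ | q.1 < q.2} :=
    measurableSet_lt measurable_fst measurable_snd
  have hswap : P {ω | B ω < A ω} = P {ω | A ω < B ω} := by
    have h1 := Measure.map_apply (μ := P) (hA.prodMk hB) hms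
    have h2 := Measure.map_apply (μ := P) (hB.prodMk hA) hms
    rw [hp] at h1
    rw [hp', h1] at h2
    exact h2.symm
  have hne := hAB.ae_ne hA hB
  have hcompl : P {ω | A ω < B ω}ᶜ = P {ω | B ω < A ω} := by
    refine measure_congr ?_
    filter_upwards [hne] with ω hω
    exact propext ⟨fun h => lt_of_le_of_ne (not_lt.1 h) hω.symm, fun h => not_lt.2 (le_of_lt h)⟩
  have hsum := prob_add_prob_compl (μ := P) (measurableSet_lt hA hB)
  rw [hcompl, hswap, ← two_mul] at hsum
  rw [ENNReal.eq_div_iff (by norm_num) (by norm_num), hsum]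

end Uniform

/-! ### Transfer to a continuous cdf -/

section ContinuousCdf

variable {Ω : Type*} [MeasurableSpace Ω] {P : Measure Ω} [IsProbabilityMeasure P]
  {F : StieltjesFunction ℝ} {X : ℕ → Ω → ℝ}

theorem ae_recordValue_cdf_comp (hF : Continuous F) (hXm : ∀ i, Measurable (X i))
    (hX : iIndepFun X P) (hcdf : ∀ i, cdf (P.map (X i)) = F) {k : ℕ} (hk : 1 ≤ k) (n : ℕ) :
    (fun ω => recordValue (fun i => F (X i ω)) k n) =ᵐ[P]
      fun ω => F (recordValue (fun i => X i ω) k n) := by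
  have hUm : ∀ i, Measurable fun ω => F (X i ω) := fun i => hF.measurable.comp (hXm i)
  have hUind : iIndepFun (fun i ω => F (X i ω)) P := hX.comp (fun _ => F) fun _ => hF.measurable
  have hU := fun i => map_cdf_comp_eq_uniform hF (hXm i) (hcdf i)
  filter_upwards [ae_accumulatesAtOne_of_uniform hUm hUind hU,
    ae_injective_of_uniform hUm hUind hU] with ω hacc hinj
  refine recordValue_comp (fun a ha b hb hab => ?_) hacc hk n
  obtain ⟨i, rfl⟩ := ha
  obtain ⟨j, rfl⟩ := hb
  refine lt_of_le_of_ne (F.mono hab.le) fun h => ?_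
  rw [hinj h] at hab
  exact lt_irrefl _ hab

/-- The events `R ≤ x` and `F(R) ≤ F(x)` differ only where `F(R) = F(x)`, a null event even if `F`
is flat near `x`. -/
theorem cdf_map_eq_cdf_map_comp {R : Ω → ℝ} (hR : Measurable R) (hF : Continuous F)
    [NullSingletonClass (P.map fun ω => F (R ω))] (x : ℝ) :
    cdf (P.map R) x = cdf (P.map fun ω => F (R ω)) (F x) := by
  have hFR : Measurable fun ω => F (R ω) := hF.measurable.comp hR
  have : IsProbabilityMeasure (P.map R) := Measure.isProbabilityMeasure_map hR.aemeasurable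
  have : IsProbabilityMeasure (P.map fun ω => F (R ω)) :=
    Measure.isProbabilityMeasure_map hFR.aemeasurable
  rw [cdf_eq_real, cdf_eq_real, map_measureReal_apply hR measurableSet_Iic,
    map_measureReal_apply hFR measurableSet_Iic]
  refine measureReal_congr ?_
  have hne : ∀ᵐ ω ∂P, F (R ω) ≠ F x := by
    exact ae_of_ae_map hFR.aemeasurable ((countable_singleton (F x)).ae_notMem _)
  filter_upwards [hne] with ω hω
  exact propext ⟨fun h => F.mono h,
    fun h => (F.mono.reflect_lt (lt_of_le_of_ne h hω)).le⟩

end ContinuousCdf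

/-! ### Quantile comparison and the theorem -/

theorem leftContInverse_le_of_le {f g : ℝ → ℝ} {u : ℝ}
    (hfg : ∀ x, u ≤ g x → u ≤ f x) (hf : Tendsto f atBot (𝓝 0)) (hfm : Monotone f)
    (hg : Tendsto g atTop (𝓝 1)) (hu : u ∈ Ioo (0 : ℝ) 1) :
    leftContInverse f u ≤ leftContInverse g u := by
  -- The limits keep the infima genuine: one set is bounded below, the other nonempty.
  obtain ⟨a, ha⟩ := (hf.eventually_lt_const hu.1).exists
  obtain ⟨b, hb⟩ := (hg.eventually_const_lt hu.2).exists
  exact csInf_le_csInf ⟨a, fun x hx => (hfm.reflect_lt (ha.trans_le hx)).le⟩ ⟨b, hb.le⟩ hfg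

theorem mainTheorem11 {Ω : Type*} [MeasurableSpace Ω] (P : Measure Ω) [IsProbabilityMeasure P]
    (F G : StieltjesFunction ℝ) (hF : Continuous F) (hG : Continuous G)
    (X Y : ℕ → Ω → ℝ)
    (hXm : ∀ i, Measurable (X i)) (hYm : ∀ i, Measurable (Y i))
    (hXindep : iIndepFun X P) (hYindep : iIndepFun Y P)
    (hXcdf : ∀ i, cdf (P.map (X i)) = F) (hYcdf : ∀ i, cdf (P.map (Y i)) = G)
    (hFG : ∃ d : ℝ, G d < 1 ∧ ∀ x, d ≤ x → G x ≤ F x) :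
    (∀ k : ℕ, 1 ≤ k →
      AsympUsualOrder P
        (fun (n : ℕ) ω => recordValue (fun i => X i ω) k n)
        (fun (n : ℕ) ω => recordValue (fun i => Y i ω) k n)) ∧
    (IndepFun (fun ω i => X i ω) (fun ω i => Y i ω) P →
      ∀ k : ℕ, 1 ≤ k →
        AsympPrecedenceOrder P
          (fun (n : ℕ) ω => recordValue (fun i => X i ω) k n)
          (fun (n : ℕ) ω => recordValue (fun i => Y i ω) k n)) := by
  obtain ⟨d, hd, hFG⟩ := hFG
  have hUm : ∀ i, Measurable fun ω => F (X i ω) := fun i => hF.measurable.comp (hXm i)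
  have hVm : ∀ i, Measurable fun ω => G (Y i ω) := fun i => hG.measurable.comp (hYm i)
  have hUind : iIndepFun (fun i ω => F (X i ω)) P :=
    hXindep.comp (fun _ => F) fun _ => hF.measurable
  have hVind : iIndepFun (fun i ω => G (Y i ω)) P :=
    hYindep.comp (fun _ => G) fun _ => hG.measurable
  have hU := fun i => map_cdf_comp_eq_uniform hF (hXm i) (hXcdf i)
  have hV := fun i => map_cdf_comp_eq_uniform hG (hYm i) (hYcdf i)
  have hRm : ∀ k n, Measurable fun ω => recordValue (fun i => X i ω) k n := fun k n =>
    (measurable_recordValue k n).comp (measurable_pi_lambda _ hXm)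
  have hSm : ∀ k n, Measurable fun ω => recordValue (fun i => Y i ω) k n := fun k n =>
    (measurable_recordValue k n).comp (measurable_pi_lambda _ hYm)
  have hlaw : ∀ k, 1 ≤ k → ∀ n, P.map (fun ω => F (recordValue (fun i => X i ω) k n)) =
      P.map (fun ω => G (recordValue (fun i => Y i ω) k n)) := by
    intro k hk n
    rw [← Measure.map_congr (ae_recordValue_cdf_comp hF hXm hXindep hXcdf hk n),
      ← Measure.map_congr (ae_recordValue_cdf_comp hG hYm hYindep hYcdf hk n)]
    exact map_recordValue_eq_of_uniform hUm hVm hUind hVind hU hV k n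
  have hatoms : ∀ k, 1 ≤ k → ∀ n,
      NullSingletonClass (P.map fun ω => G (recordValue (fun i => Y i ω) k n)) := by
    intro k hk n
    rw [← Measure.map_congr (ae_recordValue_cdf_comp hG hYm hYindep hYcdf hk n)]
    exact nullSingletonClass_map_recordValue_of_uniform hVm hVind hV hk n
  have htend : ∀ k, 1 ≤ k → Tendsto
      (fun n => P {ω | G (recordValue (fun i => Y i ω) k n) ≤ G d}) atTop (𝓝 0) := by
    intro k hk
    refine (tendsto_measure_recordValue_le_of_uniform hVm hVind hV hk hd).congr fun n => ?_
    refine measure_congr ?_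
    filter_upwards [ae_recordValue_cdf_comp hG hYm hYindep hYcdf hk n] with ω hω
    exact congrArg (· ≤ G d) hω
  refine ⟨fun k hk => ?_, fun hXY k hk => ?_⟩
  · refine tendsto_of_tendsto_of_tendsto_of_le_of_le tendsto_const_nhds (htend k hk)
      (fun _ => zero_le) fun n => ?_
    have hGS : Measurable fun ω => G (recordValue (fun i => Y i ω) k n) :=
      hG.measurable.comp (hSm k n)
    have : IsProbabilityMeasure (P.map fun ω => recordValue (fun i => X i ω) k n) :=
      Measure.isProbabilityMeasure_map (hRm k n).aemeasurable
    have : IsProbabilityMeasure (P.map fun ω => G (recordValue (fun i => Y i ω) k n)) :=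
      Measure.isProbabilityMeasure_map hGS.aemeasurable
    have := hatoms k hk n
    have : NullSingletonClass (P.map fun ω => F (recordValue (fun i => X i ω) k n)) :=
      (hlaw k hk n).symm ▸ hatoms k hk n
    set H := cdf (P.map fun ω => G (recordValue (fun i => Y i ω) k n)) with hH
    have hcR : ∀ x, cdf (P.map fun ω => recordValue (fun i => X i ω) k n) x = H (F x) :=
      fun x => by rw [cdf_map_eq_cdf_map_comp (hRm k n) hF, hlaw k hk n]
    have hcS : ∀ x, cdf (P.map fun ω => recordValue (fun i => Y i ω) k n) x = H (G x) :=
      fun x => by rw [cdf_map_eq_cdf_map_comp (hSm k n) hG]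
    have hsub : {u : ℝ | u ∈ Ioo (0 : ℝ) 1 ∧
        leftContInverse (cdf (P.map fun ω => recordValue (fun i => Y i ω) k n)) u <
          leftContInverse (cdf (P.map fun ω => recordValue (fun i => X i ω) k n)) u} ⊆
        Ioc 0 (H (G d)) := by
      rintro u ⟨hu, hlt⟩
      refine ⟨hu.1, not_lt.1 fun hHu => not_le.2 hlt ?_⟩
      refine leftContInverse_le_of_le (fun x hx => ?_) (tendsto_cdf_atBot _) (monotone_cdf _)
        (tendsto_cdf_atTop _) hu
      rw [hcS] at hx
      rw [hcR]
      -- Here `H(G d) < u ≤ H(G x)`, so `x` lies where `G ≤ F`.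
      have hdx : d < x := G.mono.reflect_lt (H.mono.reflect_lt (hHu.trans_le hx))
      exact hx.trans (H.mono (hFG x hdx.le))
    refine (measure_mono hsub).trans_eq ?_
    rw [Real.volume_Ioc, sub_zero, hH, ofReal_cdf, Measure.map_apply hGS measurableSet_Iic]
    rfl
  · have hbound : ∀ n, (1 / 2 : ℝ≥0∞) - P {ω | G (recordValue (fun i => Y i ω) k n) ≤ G d} ≤
        P {ω | recordValue (fun i => X i ω) k n ≤ recordValue (fun i => Y i ω) k n} := by
      intro n
      have := hatoms k hk n
      have hindep : IndepFun (fun ω => F (recordValue (fun i => X i ω) k n))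
          (fun ω => G (recordValue (fun i => Y i ω) k n)) P :=
        hXY.comp (hF.measurable.comp (measurable_recordValue k n))
          (hG.measurable.comp (measurable_recordValue k n))
      rw [← measure_lt_eq_half_of_indepFun
        (A := fun ω => F (recordValue (fun i => X i ω) k n))
        (B := fun ω => G (recordValue (fun i => Y i ω) k n))
        (hF.measurable.comp (hRm k n)) (hG.measurable.comp (hSm k n)) hindep (hlaw k hk n),
        tsub_le_iff_right]
      refine (measure_mono fun ω hω => ?_).trans (measure_union_le _ _)
      rcases le_or_gt (recordValue (fun i => Y i ω) k n) d with h | h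
      · exact Or.inr (G.mono h)
      · exact Or.inl (F.mono.reflect_lt (lt_of_lt_of_le hω (hFG _ h.le))).le
    have hlim : Tendsto (fun n => (1 / 2 : ℝ≥0∞) -
        P {ω | G (recordValue (fun i => Y i ω) k n) ≤ G d}) atTop (𝓝 (1 / 2)) := by
      simpa using ENNReal.Tendsto.sub tendsto_const_nhds (htend k hk) (Or.inl (by simp))
    exact hlim.liminf_eq.symm.trans_le (liminf_le_liminf (Eventually.of_forall hbound))
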